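/- A real symmetric $m\times m$ matrix $X$ is completely positive semidefinite (cpsd) if, for some integer $d\ge 1$, there are $d\times d$ complex Hermitian positive semidefinite matrices $P_1,\dots,P_m$ with $X_{ij}=\mathrm{Tr}(P_iP_j)$ for all $i,j\in\{1,\dots,m\}$; the least such $d\ge 1$ is the cpsd-rank of $X$, and $\mathcal{CS}_+^m$ denotes the set of $m\times m$ cpsd matrices. For $n\in\mathbb{N}$ let $r_{\max}(n)$ be the greatest integer $r$ with $\binom{r+1}{2}\le n$. **Theorem.** For every $n\in\mathbb{N}$, $$r_{\max}(n)=\left\lfloor\frac{\sqrt{1+8n}-1}{2}\right\rfloor,$$ and there exists a matrix $X_n\in\mathcal{CS}_+^{2n}$ such that $$\text{cpsd-rank}(X_n)\ \ge\ 2^{\lfloor r_{\max}(n)/2\rfloor}.$$ This lower bound is sub-exponential in $n$, in the following sense: $\lfloor r_{\max}(n)/2\rfloor=\Theta(\sqrt n)$ as $n\to\infty$, so that the lower bound is $2^{\Theta(\sqrt n)}$. -/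

import Mathlib

open scoped ComplexOrder

/-- `P` is a cpsd-factorization of size `d` of the real matrix `X`: the `P i` are `d × d` complex
Hermitian positive semidefinite matrices with `X i j = Tr (P i * P j)` for all `i`, `j`. -/
def IsCpsdFactorization {ι : Type*} {d : ℕ} (X : Matrix ι ι ℝ)
    (P : ι → Matrix (Fin d) (Fin d) ℂ) : Prop :=
  (∀ i, (P i).PosSemidef) ∧ ∀ i j, ((X i j : ℝ) : ℂ) = (P i * P j).trace

/-- The set `𝒞𝒮₊ᵐ` of `m × m` completely positive semidefinite matrices. -/
def cpsdCone (m : ℕ) : Set (Matrix (Fin m) (Fin m) ℝ) :=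
  {X | X.IsSymm ∧ ∃ d : ℕ, 1 ≤ d ∧
    ∃ P : Fin m → Matrix (Fin d) (Fin d) ℂ, IsCpsdFactorization X P}

/-- The cpsd-rank of `X`: the least `d ≥ 1` for which `X` has a cpsd-factorization of size `d`.
It is meaningful for `X` in `cpsdCone m`, where the set below is nonempty. -/
noncomputable def cpsdRank {m : ℕ} (X : Matrix (Fin m) (Fin m) ℝ) : ℕ :=
  sInf {d : ℕ | 1 ≤ d ∧ ∃ P : Fin m → Matrix (Fin d) (Fin d) ℂ, IsCpsdFactorization X P}

/-- The greatest natural number `r` with `(r + 1).choose 2 ≤ n`. -/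
noncomputable def rMax (n : ℕ) : ℕ := sSup {r : ℕ | (r + 1).choose 2 ≤ n}

/-- The supremum defining `rMax n` is attained. -/
theorem rMax_isGreatest (n : ℕ) : IsGreatest {r : ℕ | (r + 1).choose 2 ≤ n} (rMax n) := by
  have hb : BddAbove {r : ℕ | (r + 1).choose 2 ≤ n} := by
    refine ⟨n, fun r hr => ?_⟩
    have h : (r + 1).choose 2 = r.choose 1 + r.choose 2 := Nat.choose_succ_succ' r 1
    have hr' : (r + 1).choose 2 ≤ n := hr
    rw [h, Nat.choose_one_right] at hr'
    omega
  exact ⟨Nat.sSup_mem ⟨0, by simp⟩ hb, fun r hr => le_csSup hb hr⟩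

/-- On the cpsd cone, the minimum defining the cpsd-rank is attained. -/
theorem cpsdRank_isLeast {m : ℕ} {X : Matrix (Fin m) (Fin m) ℝ} (hX : X ∈ cpsdCone m) :
    IsLeast {d : ℕ | 1 ≤ d ∧ ∃ P : Fin m → Matrix (Fin d) (Fin d) ℂ, IsCpsdFactorization X P}
      (cpsdRank X) :=
  ⟨Nat.sInf_mem hX.2, fun _ hd => Nat.sInf_le hd⟩

/-!
The matrix `X` is the Gram matrix of the projections `(1 ± B i) / 2`, where the `B i` are Hermitian
unitaries. Given anticommuting Hermitian unitaries `γ 0, …, γ (r - 1)` (`r = rMax n`), the `B i` are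
the `γ k` together with the combinations `3/5 γ k + 4/5 γ l` for `k < l`; there are
`(r + 1).choose 2 ≤ n` of them, and repetitions fill up the remaining indices.

For the lower bound, let `Q` be any factorization of `X`. Families of Hermitian matrices with the
same Gram matrix satisfy the same real linear relations (`linearCombination_eq_zero_of_gram_eq`).
Hence `ρ = Q (0, i) + Q (1, i)` is nonzero and does not depend on `i`, and the differences
`A i = Q (0, i) - Q (1, i)` satisfy the linear relations of the `B i`. Moreover
`Q (0, i) * Q (1, i)` has trace zero, hence vanishes, so that `A i ^ 2 = ρ ^ 2` and `A i` commutes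
with `ρ`. If `A i = 3/5 A k + 4/5 A l`, then squaring gives `A k * A l + A l * A k = 0`. So an
eigenspace of `ρ` for a nonzero eigenvalue is a representation of the Clifford algebra on `r`
generators, and such a representation has dimension at least `2 ^ (r / 2)`
(`two_pow_le_finrank_of_anticommuting`).
-/

/-! ### The size of `rMax n` -/

theorem rMax_eq_floor (n : ℕ) :
    (rMax n : ℤ) = ⌊(Real.sqrt (1 + 8 * (n : ℝ)) - 1) / 2⌋ := by
  have key : ∀ r : ℕ, ((r + 1).choose 2 ≤ n ↔ (2 * (r : ℝ) + 1) ^ 2 ≤ 1 + 8 * n) := by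
    intro r
    -- `r (r + 1) / 2 ≤ n`, after completing the square
    have h : (((r + 1).choose 2 : ℕ) : ℝ) = (r + 1) * r / 2 := by
      rw [Nat.cast_choose_two]; push_cast; ring
    rw [← Nat.cast_le (α := ℝ), h]
    constructor <;> intro h <;> nlinarith
  obtain ⟨h1, h2⟩ := rMax_isGreatest n
  have h1' := (key _).1 h1
  have h3 : ¬ (rMax n + 1 + 1).choose 2 ≤ n := fun h => by
    have := h2 h
    omega
  rw [key, not_le] at h3
  push_cast at h3
  have hs := Real.le_sqrt_of_sq_le h1'
  have ht := (Real.sqrt_lt' (by positivity)).2 h3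
  rw [eq_comm, Int.floor_eq_iff]
  push_cast
  constructor <;> linarith

theorem isTheta_rMax_div_two : Asymptotics.IsTheta Filter.atTop
      (fun n : ℕ => ((rMax n / 2 : ℕ) : ℝ)) (fun n : ℕ => Real.sqrt (n : ℝ)) := by
  have key : ∀ n : ℕ, (rMax n : ℝ) ≤ (Real.sqrt (1 + 8 * (n : ℝ)) - 1) / 2 ∧
      (Real.sqrt (1 + 8 * (n : ℝ)) - 1) / 2 < rMax n + 1 := fun n => by
    have := (Int.floor_eq_iff.1 (rMax_eq_floor n).symm)
    exact_mod_cast this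
  constructor
  · refine Asymptotics.IsBigO.of_bound 1 ?_
    filter_upwards [Filter.eventually_ge_atTop 1] with n hn
    have hn' : (1 : ℝ) ≤ n := by exact_mod_cast hn
    have h2 : Real.sqrt (1 + 8 * (n : ℝ)) ≤ 3 * Real.sqrt n := by
      rw [Real.sqrt_le_left (by positivity), mul_pow, Real.sq_sqrt (by positivity)]
      linarith
    have h3 : ((rMax n / 2 : ℕ) : ℝ) ≤ (rMax n : ℝ) / 2 := Nat.cast_div_le
    rw [Real.norm_of_nonneg (by positivity), Real.norm_of_nonneg (by positivity)]
    linarith [(key n).1, Real.sqrt_nonneg (n : ℝ)]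
  · refine Asymptotics.IsBigO.of_bound 4 ?_
    filter_upwards [Filter.eventually_ge_atTop 25] with n hn
    have hn' : (25 : ℝ) ≤ n := by exact_mod_cast hn
    have h2 : 2 * Real.sqrt n ≤ Real.sqrt (1 + 8 * (n : ℝ)) := by
      apply Real.le_sqrt_of_sq_le
      rw [mul_pow, Real.sq_sqrt (by positivity)]
      linarith
    have h5 : 5 ≤ Real.sqrt n := Real.le_sqrt_of_sq_le (by linarith)
    have h3 : (rMax n : ℝ) ≤ 2 * ((rMax n / 2 : ℕ) : ℝ) + 1 := by
      have : rMax n ≤ 2 * (rMax n / 2) + 1 := by omega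
      exact_mod_cast this
    rw [Real.norm_of_nonneg (by positivity), Real.norm_of_nonneg (by positivity)]
    linarith [(key n).2]

/-! ### Representations of Clifford algebras -/

/-- An invariant subspace on which `2 * m` operators anticommute and square to the same nonzero
scalar has dimension at least `2 ^ m`. In the inductive step, the eigenspace `U` of `T 0` for a
square root of `c` is mapped by `T 1` to a subspace disjoint from it, and the products
`T 1 * T (k + 2)` are `2 * m` operators on `U` of the same kind, with square `-c ^ 2`. -/
theorem two_pow_le_finrank_of_anticommuting {V : Type*} [AddCommGroup V] [Module ℂ V]
    [FiniteDimensional ℂ V] (m : ℕ) (W : Submodule ℂ V) (hW : W ≠ ⊥) (T : ℕ → Module.End ℂ V)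
    (c : ℂ) (hc : c ≠ 0) (hinv : ∀ k < 2 * m, ∀ w ∈ W, T k w ∈ W)
    (hsq : ∀ k < 2 * m, ∀ w ∈ W, T k (T k w) = c • w)
    (hanti : ∀ k < 2 * m, ∀ l < 2 * m, k ≠ l → ∀ w ∈ W, T k (T l w) = -T l (T k w)) :
    2 ^ m ≤ Module.finrank ℂ W := by
  induction m generalizing W T c with
  | zero => exact Submodule.one_le_finrank_iff.2 hW
  | succ m ih =>
    obtain ⟨μ, hμ⟩ := IsAlgClosed.exists_pow_nat_eq c (n := 2) (by norm_num)
    have hμ0 : μ ≠ 0 := by rintro rfl; exact hc (by rw [← hμ]; norm_num)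
    have h0 : 0 < 2 * (m + 1) := by omega
    have h1 : 1 < 2 * (m + 1) := by omega
    have h01 := hanti 0 h0 1 h1 (by norm_num)
    let U : Submodule ℂ V := W ⊓ LinearMap.ker (T 0 - μ • 1)
    have hmem : ∀ w, w ∈ U ↔ w ∈ W ∧ T 0 w = μ • w := fun w => by
      simp [U, sub_eq_zero]
    have hU : U ≠ ⊥ := by
      obtain ⟨w, hw, hw0⟩ := Submodule.exists_mem_ne_zero_of_ne_bot hW
      intro hbot
      -- If `U = ⊥`, then `T 0 = -μ` on `W`, so `T 1` maps `W` into the `μ`-eigenspace `U`.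
      have hz : ∀ v, v ∈ W → T 0 v = μ • v → v = 0 := fun v h h' => by
        have := (hmem v).2 ⟨h, h'⟩
        rwa [hbot, Submodule.mem_bot] at this
      have hm : T 0 w = -(μ • w) := by
        have := hz (T 0 w + μ • w) (W.add_mem (hinv 0 h0 w hw) (W.smul_mem _ hw)) (by
          rw [map_add, hsq 0 h0 w hw, map_smul, ← hμ]; module)
        exact eq_neg_of_add_eq_zero_left this
      have h1w : T 1 w = 0 := hz _ (hinv 1 h1 w hw) (by
        rw [h01 w hw, hm, map_neg, map_smul, neg_neg])
      have := hsq 1 h1 w hw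
      rw [h1w, map_zero, eq_comm, smul_eq_zero] at this
      tauto
    have hrank : 2 * Module.finrank ℂ U ≤ Module.finrank ℂ W := by
      have hinj : Set.InjOn (T 1) U := by
        intro x hx y hy hxy
        have hx' := hsq 1 h1 x ((hmem x).1 hx).1
        have hy' := hsq 1 h1 y ((hmem y).1 hy).1
        rw [hxy, hy'] at hx'
        exact (smul_right_injective V hc hx').symm
      have e1 : Module.finrank ℂ (U.map (T 1)) = Module.finrank ℂ U := by
        have hinj' : Function.Injective ((T 1).domRestrict U) := fun x y h =>
          Subtype.ext (hinj x.2 y.2 h)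
        rw [← LinearMap.range_domRestrict]
        exact LinearMap.finrank_range_of_inj hinj'
      have hdisj : U ⊓ U.map (T 1) = ⊥ := by
        rw [eq_bot_iff]
        rintro x ⟨hx, y, hy, rfl⟩
        have hy' := (hmem y).1 hy
        have hx' := ((hmem _).1 hx).2
        rw [h01 y hy'.1, hy'.2, map_smul, neg_eq_iff_add_eq_zero, ← add_smul, smul_eq_zero] at hx'
        rcases hx' with h | h
        · exact absurd (by linear_combination h / 2) hμ0
        · exact h
      have hle : U ⊔ U.map (T 1) ≤ W := by
        refine sup_le inf_le_left ?_
        rintro _ ⟨y, hy, rfl⟩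
        exact hinv 1 h1 y ((hmem y).1 hy).1
      have := Submodule.finrank_sup_add_finrank_inf_eq U (U.map (T 1))
      rw [hdisj, finrank_bot, e1] at this
      have := Submodule.finrank_mono hle
      omega
    have hrec := ih U hU (fun k => T 1 * T (k + 2)) (-c ^ 2) (by simpa using hc) ?_ ?_ ?_
    · rw [pow_succ]; omega
    · intro k hk w hw
      have hw' := (hmem w).1 hw
      have hk' : k + 2 < 2 * (m + 1) := by omega
      refine (hmem _).2 ⟨hinv 1 h1 _ (hinv _ hk' _ hw'.1), ?_⟩
      rw [Module.End.mul_apply, h01 _ (hinv _ hk' _ hw'.1), hanti 0 h0 _ hk' (by omega) _ hw'.1,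
        hw'.2]
      simp
    · intro k hk w hw
      have hw' := ((hmem w).1 hw).1
      have hk' : k + 2 < 2 * (m + 1) := by omega
      rw [Module.End.mul_apply, Module.End.mul_apply,
        hanti _ hk' 1 h1 (by omega) _ (hinv _ hk' _ hw'), map_neg, hsq _ hk' _ hw', map_smul,
        map_smul, hsq 1 h1 _ hw']
      module
    · intro k hk l hl hkl w hw
      have hw' := ((hmem w).1 hw).1
      have hk' : k + 2 < 2 * (m + 1) := by omega
      have hl' : l + 2 < 2 * (m + 1) := by omega
      simp only [Module.End.mul_apply]
      rw [hanti _ hk' 1 h1 (by omega) _ (hinv _ hl' _ hw'),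
        hanti _ hl' 1 h1 (by omega) _ (hinv _ hk' _ hw'),
        hanti _ hk' _ hl' (by omega) _ hw']
      simp

/-- The matrices `A k` preserve an eigenspace of `ρ` for some eigenvalue `t ≠ 0`, and there they
anticommute and square to `t ^ 2`. -/
theorem two_pow_le_of_anticommuting_matrices {d : ℕ} (r : ℕ) {ρ : Matrix (Fin d) (Fin d) ℂ}
    (hρ : ρ.IsHermitian) (hρ0 : ρ ≠ 0) (A : ℕ → Matrix (Fin d) (Fin d) ℂ)
    (hcomm : ∀ k < r, A k * ρ = ρ * A k) (hsq : ∀ k < r, A k * A k = ρ * ρ)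
    (hanti : ∀ k < r, ∀ l < r, k ≠ l → A k * A l = -(A l * A k)) :
    2 ^ (r / 2) ≤ d := by
  obtain ⟨v, t, ht, hv, hvt⟩ := hρ.exists_eigenvector_of_ne_zero hρ0
  let W := LinearMap.ker (Matrix.toLin' ρ - (t : ℂ) • (1 : Module.End ℂ (Fin d → ℂ)))
  have hmem : ∀ w, w ∈ W ↔ ρ.mulVec w = (t : ℂ) • w := fun w => by
    simp [W, sub_eq_zero]
  have hW : W ≠ ⊥ := (Submodule.ne_bot_iff _).2 ⟨v, (hmem v).2 (by rw [hvt]; ext; simp), hv⟩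
  have hlt : ∀ k < 2 * (r / 2), k < r := fun k hk => by omega
  refine (two_pow_le_finrank_of_anticommuting (r / 2) W hW (fun k => Matrix.toLin' (A k))
    ((t : ℂ) ^ 2) (by simpa using ht) ?_ ?_ ?_).trans
    ((Submodule.finrank_le W).trans_eq (by simp))
  · intro k hk w hw
    rw [hmem] at hw ⊢
    rw [Matrix.toLin'_apply, Matrix.mulVec_mulVec, ← hcomm k (hlt k hk), ← Matrix.mulVec_mulVec,
      hw, Matrix.mulVec_smul]
  · intro k hk w hw
    rw [hmem] at hw
    rw [Matrix.toLin'_apply, Matrix.toLin'_apply, Matrix.mulVec_mulVec, hsq k (hlt k hk),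
      ← Matrix.mulVec_mulVec, hw, Matrix.mulVec_smul, hw]
    module
  · intro k hk l hl hkl w _
    simp only [Matrix.toLin'_apply, Matrix.mulVec_mulVec]
    rw [hanti k (hlt k hk) l (hlt l hl) hkl, Matrix.neg_mulVec]

/-- Anticommuting Hermitian unitaries exist in any number `r`: `diag(γ k, -γ k)` for the given
`γ k`, together with the swap of the two blocks, is one generator more. -/
theorem exists_clifford_generators (r : ℕ) : ∃ (N : ℕ) (γ : ℕ → Matrix (Fin N) (Fin N) ℂ),
    1 ≤ N ∧ (∀ k < r, (γ k).IsHermitian) ∧ (∀ k < r, γ k * γ k = 1) ∧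
      ∀ k < r, ∀ l < r, k ≠ l → γ k * γ l = -(γ l * γ k) := by
  induction r with
  | zero => exact ⟨1, fun _ => 1, le_rfl, by simp, by simp, by simp⟩
  | succ r ih =>
    obtain ⟨N, γ, hN, hH, hsq, hanti⟩ := ih
    let δ : ℕ → Matrix (Fin N ⊕ Fin N) (Fin N ⊕ Fin N) ℂ := fun k =>
      if k < r then Matrix.fromBlocks (γ k) 0 0 (-γ k) else Matrix.fromBlocks 0 1 1 0
    have hδ : ∀ k < r, δ k = Matrix.fromBlocks (γ k) 0 0 (-γ k) := fun k hk => if_pos hk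
    have hδr : δ r = Matrix.fromBlocks 0 1 1 0 := if_neg (lt_irrefl r)
    refine ⟨N + N, fun k => Matrix.reindexAlgEquiv ℂ ℂ finSumFinEquiv (δ k), by omega,
      ?_, ?_, ?_⟩
    · intro k hk
      have : (δ k).IsHermitian := by
        rcases Nat.lt_succ_iff_lt_or_eq.1 hk with h | rfl
        · rw [hδ k h]
          simp [Matrix.IsHermitian, Matrix.fromBlocks_conjTranspose, (hH k h).eq]
        · rw [hδr]
          simp [Matrix.IsHermitian, Matrix.fromBlocks_conjTranspose]
      exact this.submatrix _
    · intro k hk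
      rw [← map_mul]
      rcases Nat.lt_succ_iff_lt_or_eq.1 hk with h | rfl
      · simp [hδ k h, Matrix.fromBlocks_multiply, hsq k h]
      · simp [hδr, Matrix.fromBlocks_multiply]
    · intro k hk l hl hkl
      rw [← map_mul, ← map_mul, ← map_neg]
      congr 1
      rcases Nat.lt_succ_iff_lt_or_eq.1 hk with h | rfl <;>
      rcases Nat.lt_succ_iff_lt_or_eq.1 hl with h' | rfl
      · simp [hδ k h, hδ l h', Matrix.fromBlocks_multiply, hanti k h l h' hkl,
          Matrix.fromBlocks_neg]
      · simp [hδ k h, hδr, Matrix.fromBlocks_multiply, Matrix.fromBlocks_neg]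
      · simp [hδ l h', hδr, Matrix.fromBlocks_multiply, Matrix.fromBlocks_neg]
      · exact absurd rfl hkl

/-! ### Positive semidefinite matrices and Gram matrices -/

open scoped MatrixOrder Matrix.Norms.L2Operator in
theorem Matrix.PosSemidef.mul_eq_zero_of_trace_mul_eq_zero {m : Type*} [Fintype m]
    {P Q : Matrix m m ℂ} (hP : P.PosSemidef) (hQ : Q.PosSemidef) (h : (P * Q).trace = 0) :
    P * Q = 0 := by
  classical
  obtain ⟨C, rfl⟩ := CStarAlgebra.nonneg_iff_eq_star_mul_self.mp hP.nonneg
  obtain ⟨D, rfl⟩ := CStarAlgebra.nonneg_iff_eq_star_mul_self.mp hQ.nonneg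
  simp only [Matrix.star_eq_conjTranspose] at h ⊢
  have h0 : C * D.conjTranspose = 0 := by
    rw [← Matrix.trace_conjTranspose_mul_self_eq_zero_iff, ← h, Matrix.conjTranspose_mul,
      Matrix.conjTranspose_conjTranspose, ← Matrix.mul_assoc]
    simp only [Matrix.mul_assoc]
    rw [Matrix.trace_mul_comm D]
    simp only [Matrix.mul_assoc]
  rw [Matrix.mul_assoc, ← Matrix.mul_assoc C, h0]
  simp

theorem trace_conjTranspose_mul_self_linearCombination {κ m : Type*} [Fintype κ] [Fintype m]
    {P : κ → Matrix m m ℂ} (hP : ∀ i, (P i).IsHermitian) (c : κ → ℝ) :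
    ((Fintype.linearCombination ℝ P c).conjTranspose * Fintype.linearCombination ℝ P c).trace =
      ∑ i, ∑ j, c i • c j • (P j * P i).trace := by
  simp [Fintype.linearCombination_apply, Matrix.conjTranspose_sum, Matrix.sum_mul,
    Matrix.mul_sum, Matrix.trace_sum, (hP _).eq, Finset.smul_sum]

/-- Families of Hermitian matrices with equal Gram matrices, possibly of different sizes, satisfy
the same real linear relations: the squared Hilbert–Schmidt norm of a linear combination depends
only on the Gram matrix. -/
theorem linearCombination_eq_zero_of_gram_eq {κ m m' : Type*} [Fintype κ] [Fintype m]
    [Fintype m'] {P : κ → Matrix m m ℂ} {Q : κ → Matrix m' m' ℂ}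
    (hP : ∀ i, (P i).IsHermitian) (hQ : ∀ i, (Q i).IsHermitian)
    (h : ∀ i j, (P i * P j).trace = (Q i * Q j).trace) {c : κ → ℝ}
    (hc : Fintype.linearCombination ℝ P c = 0) : Fintype.linearCombination ℝ Q c = 0 := by
  rw [← Matrix.trace_conjTranspose_mul_self_eq_zero_iff,
    trace_conjTranspose_mul_self_linearCombination hQ]
  simp only [← h]
  rw [← trace_conjTranspose_mul_self_linearCombination hP, hc]
  simp

/-! ### The matrix of high cpsd-rank -/

/-- Every factorization `Q` with the same Gram matrix as the projections `P = (1 ± B i) / 2` has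
size at least `2 ^ (r / 2)`, provided that every pair `k ≤ l < r` occurs as some `p i`. -/
theorem two_pow_le_of_gram_eq {N d n r : ℕ} (hN : 1 ≤ N) (hn : 0 < n) (p : Fin n → ℕ × ℕ)
    (hp : ∀ k l, k ≤ l → l < r → ∃ i, p i = (k, l))
    (γ : ℕ → Matrix (Fin N) (Fin N) ℂ) (B : Fin n → Matrix (Fin N) (Fin N) ℂ)
    (hB : ∀ i, B i = if (p i).1 = (p i).2 then γ (p i).1
      else (3 / 5 : ℝ) • γ (p i).1 + (4 / 5 : ℝ) • γ (p i).2)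
    (P : Fin 2 × Fin n → Matrix (Fin N) (Fin N) ℂ)
    (hP0 : ∀ i, P (0, i) = (1 / 2 : ℝ) • (1 + B i)) (hP1 : ∀ i, P (1, i) = (1 / 2 : ℝ) • (1 - B i))
    (hPH : ∀ x, (P x).IsHermitian) (hBsq : ∀ i, B i * B i = 1)
    (Q : Fin 2 × Fin n → Matrix (Fin d) (Fin d) ℂ) (hQ : ∀ x, (Q x).PosSemidef)
    (hPQ : ∀ x y, (P x * P y).trace = (Q x * Q y).trace) : 2 ^ (r / 2) ≤ d := by
  have hQH := fun x => (hQ x).isHermitian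
  let i₀ : Fin n := ⟨0, hn⟩
  let ρ := Q (0, i₀) + Q (1, i₀)
  have hρ : ∀ i, Q (0, i) + Q (1, i) = ρ := by
    intro i
    have := linearCombination_eq_zero_of_gram_eq hPH hQH hPQ
      (c := Pi.single (0, i) 1 + Pi.single (1, i) 1 + Pi.single (0, i₀) (-1)
        + Pi.single (1, i₀) (-1)) (by
        simp only [map_add, Fintype.linearCombination_apply_single, hP0, hP1]
        module)
    simp only [map_add, Fintype.linearCombination_apply_single] at this
    rw [← sub_eq_zero, ← this]
    module
  have hρ0 : ρ ≠ 0 := by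
    intro h0
    have := linearCombination_eq_zero_of_gram_eq hQH hPH (fun x y => (hPQ x y).symm)
      (c := Pi.single (0, i₀) 1 + Pi.single (1, i₀) 1) (by
        simpa only [map_add, Fintype.linearCombination_apply_single, one_smul] using h0)
    simp only [map_add, Fintype.linearCombination_apply_single, hP0, hP1] at this
    have h1 : (1 : Matrix (Fin N) (Fin N) ℂ) = 0 := by
      rw [← this]
      module
    have := congrFun (congrFun h1 ⟨0, hN⟩) ⟨0, hN⟩
    simp at this
  have hmul : ∀ i, Q (0, i) * Q (1, i) = 0 := by
    intro i
    refine (hQ _).mul_eq_zero_of_trace_mul_eq_zero (hQ _) ?_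
    have : (1 + B i) * (1 - B i) = 0 := by
      rw [add_mul, mul_sub, mul_sub, hBsq]
      simp
    rw [← hPQ, hP0, hP1, smul_mul_smul_comm, this]
    simp
  have hmul' : ∀ i, Q (1, i) * Q (0, i) = 0 := by
    intro i
    rw [← Matrix.conjTranspose_eq_zero, Matrix.conjTranspose_mul, (hQH _).eq, (hQH _).eq, hmul]
  let A : Fin n → Matrix (Fin d) (Fin d) ℂ := fun i => Q (0, i) - Q (1, i)
  have hA2 : ∀ i, A i * A i = ρ * ρ := by
    intro i
    simp only [A, ← hρ i, add_mul, mul_add, sub_mul, mul_sub, hmul, hmul']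
    abel
  have hAρ : ∀ i, A i * ρ = ρ * A i := by
    intro i
    simp only [A, ← hρ i, add_mul, mul_add, sub_mul, mul_sub, hmul, hmul']
    abel
  choose a ha using fun k : Fin r => hp k k le_rfl k.2
  have hA3 : ∀ k l : Fin r, k < l → A (a k) * A (a l) = -(A (a l) * A (a k)) := by
    intro k l hkl
    obtain ⟨i, hi⟩ := hp k l hkl.le l.2
    -- the relation `B i = 3/5 γ k + 4/5 γ l`, written in terms of the projections
    have hne : (k : ℕ) ≠ l := fun h => hkl.ne (Fin.ext h)
    have := linearCombination_eq_zero_of_gram_eq hPH hQH hPQ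
      (c := Pi.single (0, i) 1 + Pi.single (1, i) (-1) + Pi.single (0, a k) (-3 / 5)
        + Pi.single (1, a k) (3 / 5) + Pi.single (0, a l) (-4 / 5)
        + Pi.single (1, a l) (4 / 5)) (by
        simp only [map_add, Fintype.linearCombination_apply_single, hP0, hP1, hB, ha, hi, if_true,
          if_neg hne]
        module)
    simp only [map_add, Fintype.linearCombination_apply_single] at this
    have hAi : A i = (3 / 5 : ℝ) • A (a k) + (4 / 5 : ℝ) • A (a l) := by
      rw [← sub_eq_zero, ← this]
      simp only [A]
      module
    have h2 := hA2 i
    rw [hAi] at h2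
    simp only [add_mul, mul_add, smul_mul_smul_comm, hA2] at h2
    rw [eq_neg_iff_add_eq_zero]
    -- `h2` reads `ρ² = (9/25 + 16/25) ρ² + 12/25 (A_k A_l + A_l A_k)`.
    have h3 : A (a k) * A (a l) + A (a l) * A (a k) = (25 / 12 : ℝ) •
      ((3 / 5 * (3 / 5) : ℝ) • (ρ * ρ) + (4 / 5 * (3 / 5) : ℝ) • (A (a l) * A (a k)) +
      ((3 / 5 * (4 / 5) : ℝ) • (A (a k) * A (a l)) + (4 / 5 * (4 / 5) : ℝ) • (ρ * ρ))
        - ρ * ρ) := by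
      module
    rw [h3, h2, sub_self, smul_zero]
  -- The family is extended by zero to all of `ℕ`; only indices below `r` matter.
  have hcl : ∀ k (hk : k < r), (if h : k < r then A (a ⟨k, h⟩) else 0) = A (a ⟨k, hk⟩) :=
    fun k hk => dif_pos hk
  refine two_pow_le_of_anticommuting_matrices r (((hQH _).add (hQH _)) : ρ.IsHermitian) hρ0
    (fun k => if h : k < r then A (a ⟨k, h⟩) else 0) ?_ ?_ ?_
  · intro k hk
    simpa only [hcl k hk] using hAρ _
  · intro k hk
    simpa only [hcl k hk] using hA2 _
  · intro k hk l hl hkl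
    simp only [hcl k hk, hcl l hl]
    rcases hkl.lt_or_gt with h | h
    · exact hA3 _ _ h
    · exact neg_eq_iff_eq_neg.1 (hA3 ⟨l, hl⟩ ⟨k, hk⟩ h).symm

/-- The pairs `k ≤ l < r` can be listed, with repetitions, by any `n ≥ (r + 1).choose 2` indices;
they are counted by `Sym2 (Fin r)`. -/
theorem exists_pairs_surjection {n r : ℕ} (hr : 0 < r) (h : (r + 1).choose 2 ≤ n) :
    ∃ p : Fin n → ℕ × ℕ, (∀ i, (p i).1 < r ∧ (p i).2 < r) ∧
      ∀ k l, k ≤ l → l < r → ∃ i, p i = (k, l) := by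
  have hcard : Fintype.card (Sym2 (Fin r)) ≤ Fintype.card (Fin n) := by
    simpa [Sym2.card] using h
  obtain ⟨f⟩ := Function.Embedding.nonempty_of_card_le hcard
  have : Nonempty (Sym2 (Fin r)) := ⟨s(⟨0, hr⟩, ⟨0, hr⟩)⟩
  have hsurj := Sym2.sortEquiv.surjective.comp (Function.invFun_surjective f.injective)
  let q : Fin n → {p : Fin r × Fin r // p.1 ≤ p.2} := Sym2.sortEquiv ∘ Function.invFun f
  refine ⟨fun i => ((q i).1.1, (q i).1.2), fun i => ⟨(q i).1.1.2, (q i).1.2.2⟩, ?_⟩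
  intro k l hkl hl
  obtain ⟨i, hi⟩ := hsurj ⟨(⟨k, by omega⟩, ⟨l, hl⟩), hkl⟩
  have hq : q i = _ := hi
  exact ⟨i, by simp only [hq]⟩

theorem one_le_cpsdRank {m : ℕ} {X : Matrix (Fin m) (Fin m) ℝ} (hX : X ∈ cpsdCone m) :
    1 ≤ cpsdRank X := (cpsdRank_isLeast hX).1.1

theorem exists_cpsdRank_ge (n : ℕ) : ∃ X : Matrix (Fin (2 * n)) (Fin (2 * n)) ℝ,
    X ∈ cpsdCone (2 * n) ∧ 2 ^ (rMax n / 2) ≤ cpsdRank X := by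
  obtain hr | hr := Nat.eq_zero_or_pos (rMax n)
  · have h0 : (0 : Matrix (Fin (2 * n)) (Fin (2 * n)) ℝ) ∈ cpsdCone (2 * n) :=
      ⟨by simp [Matrix.IsSymm], 1, le_rfl, 0, fun _ => Matrix.PosSemidef.zero, by simp⟩
    exact ⟨0, h0, by simpa [hr] using one_le_cpsdRank h0⟩
  have hrn : (rMax n + 1).choose 2 ≤ n := (rMax_isGreatest n).1
  have hn : 0 < n := (Nat.choose_pos (by omega)).trans_le hrn
  obtain ⟨N, γ, hN, hH, hsq, hanti⟩ := exists_clifford_generators (rMax n)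
  obtain ⟨p, hpr, hp⟩ := exists_pairs_surjection hr hrn
  let B : Fin n → Matrix (Fin N) (Fin N) ℂ := fun i => if (p i).1 = (p i).2 then γ (p i).1
      else (3 / 5 : ℝ) • γ (p i).1 + (4 / 5 : ℝ) • γ (p i).2
  have hBH : ∀ i, (B i).IsHermitian := by
    intro i
    simp only [B]
    split_ifs
    · exact hH _ (hpr i).1
    · simp [Matrix.IsHermitian, (hH _ (hpr i).1).eq, (hH _ (hpr i).2).eq]
  have hB2 : ∀ i, B i * B i = 1 := by
    intro i
    simp only [B]
    split_ifs with h
    · exact hsq _ (hpr i).1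
    · simp only [add_mul, mul_add, smul_mul_smul_comm, hsq _ (hpr i).1, hsq _ (hpr i).2,
        hanti _ (hpr i).1 _ (hpr i).2 h]
      module
  let P : Fin 2 × Fin n → Matrix (Fin N) (Fin N) ℂ := fun x =>
    if x.1 = 0 then (1 / 2 : ℝ) • (1 + B x.2) else (1 / 2 : ℝ) • (1 - B x.2)
  have hPH : ∀ x, (P x).IsHermitian := by
    intro x
    simp only [P]
    split_ifs <;> simp [Matrix.IsHermitian, (hBH x.2).eq]
  have hPP : ∀ x, P x * P x = P x := by
    intro x
    simp only [P]
    split_ifs <;>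
    · simp only [smul_mul_smul_comm, add_mul, mul_add, sub_mul, mul_sub, hB2, one_mul, mul_one]
      module
  have hPpsd : ∀ x, (P x).PosSemidef := by
    intro x
    have := Matrix.posSemidef_conjTranspose_mul_self (P x)
    rwa [(hPH x).eq, hPP] at this
  have htr : ∀ x y, (((P x * P y).trace.re : ℝ) : ℂ) = (P x * P y).trace := by
    intro x y
    rw [← Complex.conj_eq_iff_re]
    change star _ = _
    rw [← Matrix.trace_conjTranspose, Matrix.conjTranspose_mul, (hPH x).eq, (hPH y).eq,
      Matrix.trace_mul_comm]
  let e : Fin (2 * n) ≃ Fin 2 × Fin n := finProdFinEquiv.symm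
  let X : Matrix (Fin (2 * n)) (Fin (2 * n)) ℝ :=
    Matrix.of fun i j => (P (e i) * P (e j)).trace.re
  have hX : X ∈ cpsdCone (2 * n) := by
    refine ⟨?_, N, hN, fun i => P (e i), fun i => hPpsd _, fun i j => htr _ _⟩
    ext i j
    simp [X, Matrix.trace_mul_comm (P (e i))]
  refine ⟨X, hX, ?_⟩
  obtain ⟨⟨_, Q, hQ, hQX⟩, _⟩ := cpsdRank_isLeast hX
  refine two_pow_le_of_gram_eq hN hn p hp γ B (fun _ => rfl) P (fun _ => rfl) (fun _ => rfl)
    hPH hB2 (fun x => Q (e.symm x)) (fun x => hQ _) fun x y => ?_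
  rw [← hQX, ← htr]
  simp [X]

theorem theorem1p1 :
    (∀ n : ℕ,
      (rMax n : ℤ) = ⌊(Real.sqrt (1 + 8 * (n : ℝ)) - 1) / 2⌋ ∧
      ∃ X : Matrix (Fin (2 * n)) (Fin (2 * n)) ℝ,
        X ∈ cpsdCone (2 * n) ∧ 2 ^ (rMax n / 2) ≤ cpsdRank X) ∧
    Asymptotics.IsTheta Filter.atTop
      (fun n : ℕ => ((rMax n / 2 : ℕ) : ℝ)) (fun n : ℕ => Real.sqrt (n : ℝ)) :=
  ⟨fun n => ⟨rMax_eq_floor n, exists_cpsdRank_ge n⟩, isTheta_rMax_div_two⟩
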